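/- For $n\ge 1$ let $\mathbb{B}^n=\{z\in\mathbb{C}^n:\|z\|<1\}$ be the Euclidean unit ball. For a domain $\Omega\subset\mathbb{C}^n$ let $d_\Omega$ denote its Kobayashi pseudo-distance: $d_\Omega(p,q)$ is the infimum of $\sum_{i=0}^{k} \rho(\zeta_i,\omega_i)$ over all $k\ge 0$, all holomorphic maps $\varphi_0,\dots,\varphi_k:\mathbb{D}\to\Omega$ of the unit disc $\mathbb{D}\subset\mathbb{C}$ and all $\zeta_i,\omega_i\in\mathbb{D}$ with $\varphi_0(\zeta_0)=p$, $\varphi_i(\omega_i)=\varphi_{i+1}(\zeta_{i+1})$ for $0\le i<k$, and $\varphi_k(\omega_k)=q$, where $\rho(\zeta,\omega)=\tanh^{-1}\left|\frac{\zeta-\omega}{1-\zeta\bar\omega}\right|$ is the Poincaré distance on $\mathbb{D}$. **Theorem.** Let $f:\mathbb{B}^m\to\mathbb{B}^M$ be a proper holomorphic map which extends to a Lipschitz map $\overline{\mathbb{B}^m}\to\overline{\mathbb{B}^M}$ (with respect to the Euclidean norms), also denoted by $f$. Then there exists $C>0$ such that $$d_{\mathbb{B}^M}\big(f(tv),\,t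 f(v)\big)\le C$$ for all $v\in\partial\mathbb{B}^m$ and all $t\in[0,1)$. -/

import Mathlib

open Set Metric
open scoped ENNReal ComplexConjugate

noncomputable section

/-- Distance of the Poincaré metric on the unit disc of `ℂ`, in the normalization where the
distance from `0` to `z` is `artanh |z| = (1/2) log ((1 + |z|) / (1 - |z|))`. -/
def poincareDist (z w : ℂ) : ℝ :=
  Real.artanh (‖z - w‖ / ‖1 - z * conj w‖)

/-- The infimum of the Poincaré distances `d(ζ, ω)` over all holomorphic discs in `Ω` that take
`ζ` to `p` and `ω` to `q`; it is `∞` if no holomorphic disc in `Ω` contains both points. -/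
def discDist {E : Type*} [NormedAddCommGroup E] [NormedSpace ℂ E] (Ω : Set E) (p q : E) : ℝ≥0∞ :=
  ⨅ (φ : ℂ → E) (ζ : ℂ) (ω : ℂ) (_ : DifferentiableOn ℂ φ (ball 0 1))
    (_ : MapsTo φ (ball 0 1) Ω) (_ : ζ ∈ ball (0 : ℂ) 1) (_ : ω ∈ ball (0 : ℂ) 1)
    (_ : φ ζ = p) (_ : φ ω = q), ENNReal.ofReal (poincareDist ζ ω)

/-- The Kobayashi pseudo-distance of `Ω`: the infimum of the total lengths of all finite chains
`p = x 0, x 1, …, x (n + 1) = q` whose consecutive points are joined by holomorphic discs in `Ω`.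
(A chain with a point outside `Ω`, or with consecutive points on no common disc, has length `∞`.) -/
def kobayashiDist {E : Type*} [NormedAddCommGroup E] [NormedSpace ℂ E] (Ω : Set E) (p q : E) :
    ℝ≥0∞ :=
  ⨅ (n : ℕ) (x : ℕ → E) (_ : x 0 = p) (_ : x (n + 1) = q),
    ∑ i ∈ Finset.range (n + 1), discDist Ω (x i) (x (i + 1))

end

theorem discDist_le_of_two_mul_norm_sub_le {E : Type*} [NormedAddCommGroup E] [NormedSpace ℂ E]
    {p q : E} (hp : ‖p‖ < 1) (hpq : 2 * ‖q - p‖ ≤ 1 - ‖p‖) :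
    discDist (ball (0 : E) 1) p q ≤ ENNReal.ofReal (Real.artanh (1 / 2)) := by
  have h : discDist (ball (0 : E) 1) p q ≤ ENNReal.ofReal (poincareDist 0 (1 / 2)) := by
    refine iInf_le_of_le (fun ζ : ℂ => p + ζ • (2 : ℂ) • (q - p)) <| iInf_le_of_le 0 <|
      iInf_le_of_le (1 / 2) <| iInf_le_of_le (by fun_prop) <| iInf_le_of_le ?_ <|
      iInf_le_of_le (by simp) <| iInf_le_of_le ?_ <| iInf_le_of_le (by simp) <|
      iInf_le_of_le ?_ le_rfl
    · intro ζ hζ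
      rw [mem_ball_zero_iff] at hζ ⊢
      have h1 : ‖ζ • (2 : ℂ) • (q - p)‖ = ‖ζ‖ * (2 * ‖q - p‖) := by simp [norm_smul]
      rcases eq_or_lt_of_le (norm_nonneg (q - p)) with h0 | h0
      · calc _ ≤ ‖p‖ + ‖ζ • (2 : ℂ) • (q - p)‖ := norm_add_le _ _
          _ < 1 := by rw [h1, ← h0]; simpa using hp
      · calc _ ≤ ‖p‖ + ‖ζ • (2 : ℂ) • (q - p)‖ := norm_add_le _ _
          _ < ‖p‖ + 2 * ‖q - p‖ := by rw [h1]; nlinarith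
          _ ≤ 1 := by linarith
    · rw [mem_ball_zero_iff]
      norm_num
    · simp [smul_smul]
  simpa [poincareDist] using h

theorem kobayashiDist_ball_le_of_norm_le {E : Type*} [NormedAddCommGroup E] [NormedSpace ℂ E]
    {p q : E} {δ : ℝ} {n : ℕ} (hδ : 0 < δ) (hp : ‖p‖ ≤ 1 - δ) (hq : ‖q‖ ≤ 1 - δ)
    (hpq : 2 * ‖q - p‖ ≤ (n + 1) * δ) :
    kobayashiDist (ball (0 : E) 1) p q ≤
      ENNReal.ofReal ((n + 1) * Real.artanh (1 / 2)) := by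
  let _ : NormedSpace ℝ E := NormedSpace.restrictScalars ℝ ℂ E
  have hn : (0 : ℝ) < n + 1 := by positivity
  set x : ℕ → E := fun i => AffineMap.lineMap p q ((i : ℝ) / (n + 1)) with hx
  have hstep : ∀ i ∈ Finset.range (n + 1), discDist (ball (0 : E) 1) (x i) (x (i + 1)) ≤
      ENNReal.ofReal (Real.artanh (1 / 2)) := by
    intro i hi
    have hin : (i : ℝ) ≤ n + 1 := by exact_mod_cast (Finset.mem_range.1 hi).le
    have hxi : ‖x i‖ ≤ 1 - δ := by
      rw [← mem_closedBall_zero_iff]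
      exact (convex_closedBall (0 : E) (1 - δ)).lineMap_mem (by simpa using hp) (by simpa using hq)
        ⟨by positivity, (div_le_one hn).2 hin⟩
    have hdiff : ‖x (i + 1) - x i‖ = ‖q - p‖ / (n + 1) := by
      rw [← dist_eq_norm, hx, dist_lineMap_lineMap, dist_comm p q, dist_eq_norm q p,
        Real.dist_eq, ← sub_div]
      simp [abs_of_pos hn, field]
    refine discDist_le_of_two_mul_norm_sub_le (by linarith) ?_
    have : 2 * ‖q - p‖ / (n + 1) ≤ δ := (div_le_iff₀ hn).2 (by linarith)
    rw [hdiff, ← mul_div_assoc]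
    linarith
  refine iInf_le_of_le n <| iInf_le_of_le x <| iInf_le_of_le (by simp [hx]) <|
    iInf_le_of_le (by simp [hx, hn.ne']) <| (Finset.sum_le_sum hstep).trans ?_
  rw [Finset.sum_const, Finset.card_range, nsmul_eq_mul, ENNReal.ofReal_mul hn.le]
  gcongr
  rw [← Nat.cast_add_one, ENNReal.ofReal_natCast]

theorem sq_norm_one_sub_conj_mul_sub_sq_norm_sub (b w : ℂ) :
    ‖1 - conj b * w‖ ^ 2 - ‖w - b‖ ^ 2 = (1 - ‖b‖ ^ 2) * (1 - ‖w‖ ^ 2) := by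
  simp only [Complex.sq_norm, Complex.normSq_apply, Complex.sub_re, Complex.sub_im,
    Complex.mul_re, Complex.mul_im, Complex.conj_re, Complex.conj_im, Complex.one_re,
    Complex.one_im]
  ring

theorem one_sub_norm_le_norm_one_sub_conj_mul {b w : ℂ} (hw : ‖w‖ ≤ 1) :
    1 - ‖b‖ ≤ ‖1 - conj b * w‖ := by
  have h := norm_sub_norm_le 1 (conj b * w)
  rw [norm_one, norm_mul, Complex.norm_conj] at h
  nlinarith [norm_nonneg b]

/-- A consequence of the Schwarz–Pick lemma, for scalar functions on the unit ball. -/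
theorem one_sub_norm_mul_le_of_mapsTo_ball {E : Type*} [NormedAddCommGroup E] [NormedSpace ℂ E]
    {g : E → ℂ} (hd : DifferentiableOn ℂ g (ball 0 1)) (hg : MapsTo g (ball 0 1) (ball 0 1))
    {z : E} (hz : ‖z‖ < 1) : (1 - ‖g 0‖) * (1 - ‖z‖) ≤ 4 * (1 - ‖g z‖) := by
  have hg' : ∀ y ∈ ball (0 : E) 1, ‖g y‖ < 1 := fun y hy => mem_ball_zero_iff.1 (hg hy)
  set b := g 0 with hb
  have hb1 : ‖b‖ < 1 := hg' 0 (by simp)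
  have hden : ∀ y ∈ ball (0 : E) 1, 0 < ‖1 - conj b * g y‖ := fun y hy =>
    (sub_pos.2 hb1).trans_le (one_sub_norm_le_norm_one_sub_conj_mul (hg' y hy).le)
  have hS : ‖(g z - b) / (1 - conj b * g z)‖ ≤ ‖z‖ := by
    refine Complex.norm_le_norm_of_mapsTo_ball
      (f := fun y => (g y - b) / (1 - conj b * g y)) (R := 1) ?_ ?_ (by simp [hb]) hz
    · simp only [div_eq_mul_inv]
      exact (hd.sub_const b).mul (((hd.const_mul _).const_sub 1).inv
        fun y hy => norm_pos_iff.1 (hden y hy))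
    · intro y hy
      rw [mem_closedBall_zero_iff, norm_div, div_le_one (hden y hy),
        ← sq_le_sq₀ (norm_nonneg _) (norm_nonneg _), ← sub_nonneg,
        sq_norm_one_sub_conj_mul_sub_sq_norm_sub]
      have := hg' y hy
      exact mul_nonneg (by nlinarith [norm_nonneg b]) (by nlinarith [norm_nonneg (g y)])
  have hz' : z ∈ ball (0 : E) 1 := by simpa using hz
  rw [norm_div, div_le_iff₀ (hden z hz'), ← sq_le_sq₀ (norm_nonneg _) (by positivity),
    mul_pow] at hS
  have hid := sq_norm_one_sub_conj_mul_sub_sq_norm_sub b (g z)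
  have hw := hg' z hz'
  have hlow := pow_le_pow_left₀ (sub_pos.2 hb1).le
    (one_sub_norm_le_norm_one_sub_conj_mul (b := b) hw.le) 2
  have hb0 := norm_nonneg b
  have hz0 := norm_nonneg z
  have hw0 := norm_nonneg (g z)
  have h1 : (1 - ‖b‖) * ((1 - ‖b‖) * (1 - ‖z‖ ^ 2)) ≤
      (1 - ‖b‖) * ((1 + ‖b‖) * (1 - ‖g z‖ ^ 2)) := by
    nlinarith [mul_le_mul_of_nonneg_right hlow (by nlinarith : 0 ≤ 1 - ‖z‖ ^ 2)]
  have h2 := le_of_mul_le_mul_left h1 (sub_pos.2 hb1)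
  have h3 : (1 - ‖b‖) * (1 - ‖z‖) ≤ (1 - ‖b‖) * (1 - ‖z‖ ^ 2) :=
    mul_le_mul_of_nonneg_left (by nlinarith) (sub_pos.2 hb1).le
  have h4 : (1 + ‖b‖) * (1 - ‖g z‖ ^ 2) ≤ 2 * (2 * (1 - ‖g z‖)) :=
    mul_le_mul (by linarith) (by nlinarith) (by nlinarith) (by norm_num)
  linarith

/-- A holomorphic map between unit balls contracts the distance to the boundary by at most a
constant factor. -/
theorem one_sub_norm_mul_le_of_mapsTo_ball_ball {E F : Type*} [NormedAddCommGroup E]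
    [NormedSpace ℂ E] [NormedAddCommGroup F] [InnerProductSpace ℂ F]
    {f : E → F} (hd : DifferentiableOn ℂ f (ball 0 1)) (hf : MapsTo f (ball 0 1) (ball 0 1))
    {z : E} (hz : ‖z‖ < 1) : (1 - ‖f 0‖) * (1 - ‖z‖) ≤ 4 * (1 - ‖f z‖) := by
  have hf0 : ‖f 0‖ < 1 := mem_ball_zero_iff.1 (hf (by simp))
  rcases eq_or_ne (f z) 0 with h | h
  · rw [h, norm_zero]
    nlinarith [norm_nonneg (f 0), norm_nonneg z]
  obtain ⟨u, hu, huz⟩ : ∃ u : F →L[ℂ] ℂ, ‖u‖ = 1 ∧ u (f z) = ‖f z‖ :=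
    exists_dual_vector ℂ (f z) (norm_ne_zero_iff.2 h)
  have hle : ∀ y, ‖u y‖ ≤ ‖y‖ := fun y => by simpa [hu] using u.le_opNorm y
  have key := one_sub_norm_mul_le_of_mapsTo_ball (g := fun y => u (f y))
    (u.differentiable.comp_differentiableOn hd)
    (fun y hy => mem_ball_zero_iff.2 ((hle _).trans_lt (mem_ball_zero_iff.1 (hf hy)))) hz
  simp only [huz, Complex.norm_real, norm_norm] at key
  nlinarith [hle (f 0)]

/-- `F` is the Lipschitz extension of the proper holomorphic map `f` to the closed balls. -/
theorem theorem3p1 (m M : ℕ)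
    (f : EuclideanSpace ℂ (Fin m) → EuclideanSpace ℂ (Fin M))
    (hf_maps : MapsTo f (ball 0 1) (ball 0 1))
    (hf_holo : DifferentiableOn ℂ f (ball 0 1))
    (hf_proper : IsProperMap (hf_maps.restrict f (ball 0 1) (ball 0 1)))
    (F : EuclideanSpace ℂ (Fin m) → EuclideanSpace ℂ (Fin M))
    (hF_maps : MapsTo F (closedBall 0 1) (closedBall 0 1))
    (hF_lip : ∃ K : NNReal, LipschitzOnWith K F (closedBall 0 1))
    (hF_ext : EqOn F f (ball 0 1)) :
    ∃ C : ℝ, 0 < C ∧ ∀ v ∈ sphere (0 : EuclideanSpace ℂ (Fin m)) 1, ∀ t ∈ Ico (0 : ℝ) 1,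
      kobayashiDist (ball (0 : EuclideanSpace ℂ (Fin M)) 1) (f (t • v)) (t • F v)
        ≤ ENNReal.ofReal C := by
  obtain ⟨K, hK⟩ := hF_lip
  have ha : ‖f 0‖ < 1 := mem_ball_zero_iff.1 (hf_maps (by simp))
  set c : ℝ := (1 - ‖f 0‖) / 4 with hc
  have hc0 : 0 < c := by rw [hc]; linarith
  have hc1 : c ≤ 1 := by rw [hc]; linarith [norm_nonneg (f 0)]
  obtain ⟨n, hn⟩ := exists_nat_ge (2 * (K + 1) / c)
  refine ⟨(n + 1) * Real.artanh (1 / 2),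
    mul_pos (by positivity) (Real.artanh_pos (by norm_num)), fun v hv t ht => ?_⟩
  have hv1 : ‖v‖ = 1 := mem_sphere_zero_iff_norm.1 hv
  have ht1 : 0 < 1 - t := sub_pos.2 ht.2
  have htv : ‖t • v‖ = t := by rw [norm_smul, hv1, mul_one, Real.norm_of_nonneg ht.1]
  have hFv : ‖F v‖ ≤ 1 := mem_closedBall_zero_iff.1 (hF_maps (by simp [hv1]))
  have hball : t • v ∈ ball (0 : EuclideanSpace ℂ (Fin m)) 1 := by
    rw [mem_ball_zero_iff, htv]; exact ht.2
  have hlip : ‖F v - f (t • v)‖ ≤ K * (1 - t) := by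
    have h := hK.dist_le_mul v (by simp [hv1]) (t • v) (ball_subset_closedBall hball)
    rwa [dist_eq_norm, dist_eq_norm, hF_ext hball, show v - t • v = (1 - t) • v by rw [sub_smul, one_smul], norm_smul, hv1, mul_one,
      Real.norm_of_nonneg ht1.le] at h
  refine kobayashiDist_ball_le_of_norm_le (δ := c * (1 - t)) (mul_pos hc0 ht1) ?_ ?_ ?_
  · have h := one_sub_norm_mul_le_of_mapsTo_ball_ball hf_holo hf_maps (htv.trans_lt ht.2)
    rw [htv] at h
    rw [hc]
    linarith
  · rw [norm_smul, Real.norm_of_nonneg ht.1]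
    nlinarith [ht.1]
  · have h1 : ‖t • F v - f (t • v)‖ ≤ (K + 1) * (1 - t) := by
      have h2 : t • F v - f (t • v) = (F v - f (t • v)) - (1 - t) • F v := by
        rw [sub_smul, one_smul]; abel
      have h3 : ‖(1 - t) • F v‖ ≤ 1 - t := by
        rw [norm_smul, Real.norm_of_nonneg ht1.le]
        nlinarith
      rw [h2]
      linarith [norm_sub_le (F v - f (t • v)) ((1 - t) • F v)]
    rw [div_le_iff₀ hc0] at hn
    nlinarith [mul_le_mul_of_nonneg_right hn ht1.le, mul_pos hc0 ht1]
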